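/- Let $n>p$ be natural numbers, $0<\delta<1$, $\varepsilon>0$ and $\sigma>0$. Let $A$ be a random matrix, Haar-uniformly distributed on the group of real orthogonal $n\times n$ matrices, and let $C$ be a random $n\times p$ matrix, independent of $A$, with independent $N(0,\sigma^2)$ entries. Consider the release mechanisms $$\text{(B)}\quad Y(X)=A(X+C),\qquad\qquad \text{(C)}\quad Y(X)=AX+C,$$ defined for data sets $X$, i.e. real $n\times p$ matrices with all entries satisfying $|x_{ij}|\le 1$. Two data sets $X,X'$ are called neighbors if they differ in at most one row and $\|X-X'\|\le 1$, where $\|M\|=(\sum_{i,j}m_{ij}^2)^{1/2}$. Let $\gamma_{\delta,np}$ denote the upper $\delta$-quantile of the $\chi^2$ distribution with $np$ degrees of freedom, let $b=(n-p)\sqrt p+2p\,\gamma_{\delta,np}$, and suppose that $$\sigma^2\ \ge\ \frac{b+\sqrt{b^2+8np^2(n-p)\varepsilon}}{2(n-p)\varepsilon}.$$ Then, in each of the settings (B) and (C), for all neighboring data sets $X$ and $X'$, the random matrices $Y(X)$ and $Y(X')$ have densities $p_{Y(X)}$ and $p_{Y(X')}$ with respect to Lebesgue measure on $\mathbb R^{n\times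 p}$, and $$P\big[Y(X)\in\bar S_{X,X'}\big]\le\delta,\qquad\text{where } \bar S_{X,X'}=\{y:\ p_{Y(X)}(y)>e^{\varepsilon}p_{Y(X')}(y)\}.$$ -/

import Mathlib

open MeasureTheory ProbabilityTheory
open scoped ENNReal

namespace MaskedDP

/-- Real matrices carry the product sigma-algebra of their entries. -/
instance instMeasurableSpaceMatrix (m k : ℕ) : MeasurableSpace (Matrix (Fin m) (Fin k) ℝ) :=
  inferInstanceAs (MeasurableSpace (Fin m → Fin k → ℝ))

/-- The product sigma-algebra is the Borel sigma-algebra of the matrix space. -/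
instance instBorelSpaceMatrix (m k : ℕ) : BorelSpace (Matrix (Fin m) (Fin k) ℝ) :=
  inferInstanceAs (BorelSpace (Fin m → Fin k → ℝ))

/-- The group of `n × n` real orthogonal matrices is compact. -/
instance instCompactSpaceOrthogonal (n : ℕ) :
    CompactSpace (Matrix.orthogonalGroup (Fin n) ℝ) := by
  rw [← isCompact_univ_iff, Topology.IsInducing.subtypeVal.isCompact_iff, Set.image_univ,
    Subtype.range_coe]
  have hK : IsCompact (Set.univ.pi fun _ : Fin n =>
      Set.univ.pi fun _ : Fin n => Metric.closedBall (0 : ℝ) 1) :=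
    isCompact_univ_pi fun _ => isCompact_univ_pi fun _ => isCompact_closedBall 0 1
  have hcl : IsClosed (unitary (Matrix (Fin n) (Fin n) ℝ) : Set (Matrix (Fin n) (Fin n) ℝ)) :=
    isClosed_unitary
  refine IsCompact.of_isClosed_subset hK hcl ?_
  intro U hU i _ j _
  have h := entry_norm_bound_of_unitary (𝕜 := ℝ) (U := U) hU i j
  simpa using h

/-- The uniform distribution on the group of `n × n` real orthogonal matrices: its Haar measure,
normalised to have total mass one. -/
noncomputable def uniformOrthogonal (n : ℕ) : Measure (Matrix.orthogonalGroup (Fin n) ℝ) :=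
  Measure.haarMeasure ⊤

/-- Lebesgue measure on the space of `n × p` real matrices. -/
noncomputable def lebesgueMatrix (n p : ℕ) : Measure (Matrix (Fin n) (Fin p) ℝ) :=
  Measure.map Matrix.of (Measure.pi fun _ : Fin n => Measure.pi fun _ : Fin p => (volume : Measure ℝ))

/-- The law of an `n × p` matrix with independent entries of law `N(0, σ²)`. -/
noncomputable def gaussianNoise (n p : ℕ) (σ : ℝ) : Measure (Matrix (Fin n) (Fin p) ℝ) :=
  Measure.map Matrix.of
    (Measure.pi fun _ : Fin n => Measure.pi fun _ : Fin p => gaussianReal 0 (σ ^ 2).toNNReal)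

/-- The chi-square law with `k` degrees of freedom: the law of the sum of the squares of `k`
independent standard normal variables. -/
noncomputable def chiSquare (k : ℕ) : Measure ℝ :=
  Measure.map (fun z : Fin k → ℝ => ∑ i, z i ^ 2) (Measure.pi fun _ : Fin k => gaussianReal 0 1)

/-- The upper `δ`-quantile of a probability measure on the real line (for `0 < δ < 1`): the least
`t` such that the mass of `(t, ∞)` is at most `δ`. -/
noncomputable def upperQuantile (ν : Measure ℝ) (δ : ℝ) : ℝ :=
  sInf {t : ℝ | ν (Set.Ioi t) ≤ ENNReal.ofReal δ}

/-- Raw data sets: the entries are bounded by one in absolute value. -/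
def IsDataSet {n p : ℕ} (X : Matrix (Fin n) (Fin p) ℝ) : Prop :=
  ∀ i j, |X i j| ≤ 1

/-- The `L²` norm of a matrix: the square root of the sum of its squared entries. -/
noncomputable def l2Norm {n p : ℕ} (M : Matrix (Fin n) (Fin p) ℝ) : ℝ :=
  Real.sqrt (∑ i, ∑ j, M i j ^ 2)

/-- Neighbouring data sets differ in (at most) one row, by at most one in `L²` norm. -/
def IsNeighbor {n p : ℕ} (X X' : Matrix (Fin n) (Fin p) ℝ) : Prop :=
  l2Norm (X - X') ≤ 1 ∧ ∃ i, ∀ k, k ≠ i → ∀ j, X k j = X' k j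

/-- The set of all `y` with `p_Y(y) > e^ε * p_Y'(y)`, where `p_Y` and `p_Y'` are the densities
of the random matrices `Y` and `Y'` with respect to Lebesgue measure. -/
noncomputable def exceedanceSet {Ω : Type*} [MeasurableSpace Ω] {n p : ℕ} (P : Measure Ω) (ε : ℝ)
    (Y Y' : Ω → Matrix (Fin n) (Fin p) ℝ) : Set (Matrix (Fin n) (Fin p) ℝ) :=
  {y | ENNReal.ofReal (Real.exp ε) * pdf Y' P (lebesgueMatrix n p) y <
    pdf Y P (lebesgueMatrix n p) y}

/-- For all neighbouring data sets `X` and `X'`, the outputs `Y X` and `Y X'` of the release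
mechanism `Y` have densities, and the probability that `Y X` falls in the set where the density
of `Y X` exceeds `e^ε` times the density of `Y X'` is at most `δ`. -/
def DensityRatioCondition {Ω : Type*} [MeasurableSpace Ω] {n p : ℕ} (P : Measure Ω) (ε δ : ℝ)
    (Y : Matrix (Fin n) (Fin p) ℝ → Ω → Matrix (Fin n) (Fin p) ℝ) : Prop :=
  ∀ X X' : Matrix (Fin n) (Fin p) ℝ, IsDataSet X → IsDataSet X' → IsNeighbor X X' →
    HasPDF (Y X) P (lebesgueMatrix n p) ∧ HasPDF (Y X') P (lebesgueMatrix n p) ∧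
      P {ω | Y X ω ∈ exceedanceSet P ε (Y X) (Y X')} ≤ ENNReal.ofReal δ

end MaskedDP

/-!
Both mechanisms have the same law. Given `A`, the output `A X + C` is Gaussian with mean `A X`, and
so is `A (X + C)`, because Lebesgue measure and the Gaussian density are invariant under left
multiplication by an orthogonal matrix. Hence both have the density `mechanismDensity σ X`, the
Gaussian density centred at `A X` and averaged over `A`. With the Frobenius inner product and
`s = σ²`, it equals
`K exp (-(‖y‖² + ‖X‖²) / (2 s)) Z(X)`, where `Z(X) = E exp (⟨y, A X⟩ / s)`.

To compare `Z(X)` with `Z(X')` when `X` and `X'` differ only in row `i`, both are compared with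
`Z(X₀)`, where `X₀` is the common matrix obtained by deleting that row. By invariance of Haar
measure under the reflections that fix the columns of `X₀`, the value `Z(X₀ + w xᵀ)` is the same for
all unit vectors `w` orthogonal to these columns, and `X = X₀ + eᵢ xᵀ` is of this form
(`orthogonalLaplace_add_vecMulVec`).

* Using `w` and `-w`, midpoint convexity of `exp` gives `Z(X₀) ≤ Z(X')`
  (`orthogonalLaplace_le_add_vecMulVec`).
* Averaging over `w = m^(-1/2) ∑ₖ ± wₖ`, where `w₁, …, wₘ` is an orthonormal basis of the orthogonal
  complement of the columns of `X₀` and the signs are arbitrary, and using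
  `cosh r ≤ exp (r² / 2)`, one gets `Z(X) ≤ exp (‖y x‖² / (2 m s²)) Z(X₀)`, and `m ≥ n - p`
  (`orthogonalLaplace_add_vecMulVec_le`).

Since `‖x‖² ≤ p` and `‖X'‖² - ‖X‖² ≤ 2 √p`, the logarithm of the density ratio at `y` is at most
`√p / s + p ‖y‖² / (2 (n - p) s²)` (`mechanismDensity_le_of_isNeighbor`). The assumption on `s` says
that `s` is at least the larger root of a quadratic polynomial, and makes this bound at most `ε`
whenever `‖y‖² ≤ 2 n p + 2 s γ` (`logRatio_bound_le`). Since the squared norm of the output is at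
most `2 ‖X‖² + 2 ‖C‖² ≤ 2 n p + 2 ‖C‖²`, the ratio exceeds `exp ε` only if `‖C‖² > s γ`. As
`‖C‖² / s` has the chi-square law with `n p` degrees of freedom, this has probability at most `δ`
(`gaussianNoise_frobInner_gt_le`).
-/

namespace MaskedDP

open Matrix

/-! ### Averages over sign vectors -/

section SignAverage

variable {E : Type*} [NormedAddCommGroup E] [InnerProductSpace ℝ E] {m : ℕ}

/-- The point of the unit sphere with coordinates `± 1 / √m` in the orthonormal family `w`, the
signs being given by `s`. -/
noncomputable def signVector (w : Fin m → E) (s : Fin m → Bool) : E :=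
  ∑ k, ((if s k then 1 else -1) / √m : ℝ) • w k

lemma norm_signVector {w : Fin m → E} (hw : Orthonormal ℝ w) (hm : 0 < m) (s : Fin m → Bool) :
    ‖signVector w s‖ = 1 := by
  have hm' : (0 : ℝ) < m := by exact_mod_cast hm
  have h : ‖signVector w s‖ ^ 2 = 1 := by
    rw [← real_inner_self_eq_norm_sq, signVector, hw.inner_sum]
    have : ∀ k ∈ (Finset.univ : Finset (Fin m)),
        (starRingEnd ℝ) ((if s k then 1 else -1) / √m : ℝ) * ((if s k then 1 else -1) / √m : ℝ)
          = 1 / m := by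
      intro k _
      rw [conj_trivial, div_mul_div_comm, Real.mul_self_sqrt hm'.le]
      split_ifs <;> norm_num
    rw [Finset.sum_congr rfl this]
    simp [hm'.ne']
  nlinarith [norm_nonneg (signVector w s)]

/-- Summing over all signs gives a product of hyperbolic cosines, each of which is bounded by
the corresponding Gaussian moment generating function; Bessel's inequality finishes the bound. -/
lemma sum_exp_inner_signVector_le {w : Fin m → E} (hw : Orthonormal ℝ w) (v : E) :
    ∑ s : Fin m → Bool, Real.exp (inner ℝ v (signVector w s)) ≤
      2 ^ m * Real.exp (‖v‖ ^ 2 / (2 * m)) := by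
  have h1 : ∀ s : Fin m → Bool, Real.exp (inner ℝ v (signVector w s)) =
      ∏ k, (if s k then Real.exp (inner ℝ v (w k) / √m) else Real.exp (-(inner ℝ v (w k) / √m))) := by
    intro s
    rw [signVector, inner_sum, Real.exp_sum]
    refine Finset.prod_congr rfl fun k _ => ?_
    rw [real_inner_smul_right]
    split_ifs <;> congr 1 <;> ring
  have h2 := Finset.prod_univ_sum (fun _ : Fin m => (Finset.univ : Finset Bool))
    (fun k (c : Bool) => if c then Real.exp (inner ℝ v (w k) / √m)
      else Real.exp (-(inner ℝ v (w k) / √m)))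
  rw [Fintype.piFinset_univ] at h2
  simp_rw [h1]
  rw [← h2]
  have h3 : ∀ k : Fin m, (∑ c : Bool, if c then Real.exp (inner ℝ v (w k) / √m)
      else Real.exp (-(inner ℝ v (w k) / √m))) ≤
      2 * Real.exp ((inner ℝ (w k) v) ^ 2 / (2 * m)) := by
    intro k
    have h := Real.cosh_le_exp_half_sq (inner ℝ v (w k) / √m)
    rw [Real.cosh_eq, div_pow, Real.sq_sqrt (Nat.cast_nonneg m), div_div, mul_comm (m : ℝ)] at h
    rw [real_inner_comm v (w k)]
    simp only [Fintype.sum_bool, if_true, Bool.false_eq_true, if_false]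
    linarith
  refine (Finset.prod_le_prod (fun k _ => ?_) (fun k _ => h3 k)).trans ?_
  · exact Finset.sum_nonneg fun c _ => by split_ifs <;> positivity
  rw [Finset.prod_mul_distrib, Finset.prod_const, Finset.card_univ, Fintype.card_fin,
    ← Real.exp_sum, ← Finset.sum_div]
  gcongr
  have h := hw.sum_inner_products_le v (s := Finset.univ)
  simpa using h

end SignAverage

/-! ### The Frobenius inner product and reflections -/

section LinearAlgebra

variable {n p : ℕ}

/-- The Frobenius inner product of two real matrices. -/
def frobInner (M N : Matrix (Fin n) (Fin p) ℝ) : ℝ := (Mᵀ * N).trace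

lemma frobInner_eq_sum (M N : Matrix (Fin n) (Fin p) ℝ) :
    frobInner M N = ∑ i, ∑ j, M i j * N i j := by
  rw [Finset.sum_comm]
  simp [frobInner, Matrix.trace, Matrix.mul_apply]

lemma frobInner_self_eq_sum (M : Matrix (Fin n) (Fin p) ℝ) :
    frobInner M M = ∑ i, ∑ j, M i j ^ 2 := by
  simp [frobInner_eq_sum, sq]

lemma frobInner_self_nonneg (M : Matrix (Fin n) (Fin p) ℝ) : 0 ≤ frobInner M M := by
  rw [frobInner_self_eq_sum]; positivity

lemma frobInner_add_right (M N L : Matrix (Fin n) (Fin p) ℝ) :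
    frobInner M (N + L) = frobInner M N + frobInner M L := by
  simp [frobInner, Matrix.mul_add]

lemma frobInner_sub_self (M N : Matrix (Fin n) (Fin p) ℝ) :
    frobInner (M - N) (M - N) = frobInner M M + frobInner N N - 2 * frobInner M N := by
  simp only [frobInner_eq_sum, Matrix.sub_apply, Finset.mul_sum, ← Finset.sum_add_distrib,
    ← Finset.sum_sub_distrib]
  exact Finset.sum_congr rfl fun i _ => Finset.sum_congr rfl fun j _ => by ring

lemma frobInner_add_self_le (M N : Matrix (Fin n) (Fin p) ℝ) :
    frobInner (M + N) (M + N) ≤ 2 * frobInner M M + 2 * frobInner N N := by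
  simp only [frobInner_eq_sum, Matrix.add_apply, Finset.mul_sum, ← Finset.sum_add_distrib]
  exact Finset.sum_le_sum fun i _ => Finset.sum_le_sum fun j _ => by
    nlinarith [sq_nonneg (M i j - N i j)]

lemma transpose_mul_self_of_orthogonal (A : Matrix.orthogonalGroup (Fin n) ℝ) :
    (A : Matrix (Fin n) (Fin n) ℝ)ᵀ * A = 1 := by
  exact (Matrix.mem_orthogonalGroup_iff' (Fin n) ℝ).1 A.2

lemma mul_transpose_self_of_orthogonal (A : Matrix.orthogonalGroup (Fin n) ℝ) :
    (A : Matrix (Fin n) (Fin n) ℝ) * (A : Matrix (Fin n) (Fin n) ℝ)ᵀ = 1 := by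
  exact (Matrix.mem_orthogonalGroup_iff (Fin n) ℝ).1 A.2

lemma frobInner_orthogonal_mul (A : Matrix.orthogonalGroup (Fin n) ℝ)
    (M N : Matrix (Fin n) (Fin p) ℝ) :
    frobInner ((A : Matrix (Fin n) (Fin n) ℝ) * M) ((A : Matrix (Fin n) (Fin n) ℝ) * N) =
      frobInner M N := by
  rw [frobInner, Matrix.transpose_mul, Matrix.mul_assoc, ← Matrix.mul_assoc _ _ N,
    transpose_mul_self_of_orthogonal, Matrix.one_mul, frobInner]

lemma frobInner_mul_vecMulVec (A : Matrix (Fin n) (Fin n) ℝ) (y : Matrix (Fin n) (Fin p) ℝ)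
    (w : Fin n → ℝ) (x : Fin p → ℝ) :
    frobInner y (A * vecMulVec w x) = (Aᵀ *ᵥ (y *ᵥ x)) ⬝ᵥ w := by
  rw [frobInner, Matrix.mul_vecMulVec, Matrix.mul_vecMulVec, Matrix.trace_vecMulVec,
    Matrix.mulVec_transpose, ← Matrix.dotProduct_mulVec, dotProduct_comm,
    Matrix.dotProduct_mulVec, ← Matrix.mulVec_transpose]

/-- The Householder reflection in the hyperplane orthogonal to `u - w` exchanges the unit vectors
`u` and `w` and fixes every vector orthogonal to both. -/
lemma exists_orthogonal_exchanging (X₀ : Matrix (Fin n) (Fin p) ℝ) (u w : Fin n → ℝ)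
    (hu : u ⬝ᵥ u = 1) (hw : w ⬝ᵥ w = 1) (huX : u ᵥ* X₀ = 0) (hwX : w ᵥ* X₀ = 0) :
    ∃ R : Matrix.orthogonalGroup (Fin n) ℝ, (R : Matrix (Fin n) (Fin n) ℝ) *ᵥ u = w ∧
      (R : Matrix (Fin n) (Fin n) ℝ) * X₀ = X₀ := by
  by_cases huw : u = w
  · exact ⟨1, by simp [huw], by simp⟩
  set v := u - w with hv
  have hv0 : v ⬝ᵥ v ≠ 0 := by
    rw [Ne, dotProduct_self_eq_zero]; exact sub_ne_zero.2 huw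
  have hvv : v ⬝ᵥ v = 2 * (v ⬝ᵥ u) := by
    simp only [hv, sub_dotProduct, dotProduct_sub, hu, hw, dotProduct_comm w u]; ring
  set c := 2 / (v ⬝ᵥ v) with hc
  have hsq : vecMulVec v v * vecMulVec v v = (v ⬝ᵥ v) • vecMulVec v v := by
    rw [Matrix.vecMulVec_mul_vecMulVec]
    ext i j; simp [vecMulVec_apply]; ring
  have hR : (1 - c • vecMulVec v v) ∈ Matrix.orthogonalGroup (Fin n) ℝ := by
    rw [Matrix.mem_orthogonalGroup_iff]
    have hs : (1 - c • vecMulVec v v)ᵀ = 1 - c • vecMulVec v v := by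
      ext i j; simp [vecMulVec_apply, Matrix.one_apply, eq_comm, mul_comm]
    have hcc : c * (v ⬝ᵥ v) = 2 := div_mul_cancel₀ 2 hv0
    rw [hs]
    simp only [Matrix.mul_sub, Matrix.sub_mul, Matrix.one_mul, Matrix.mul_one, Matrix.smul_mul,
      Matrix.mul_smul, hsq, smul_smul, hcc, two_smul]
    abel_nf
    simp
  refine ⟨⟨_, hR⟩, ?_, ?_⟩
  · have : c * (v ⬝ᵥ u) = 1 := by rw [hc]; field_simp; linarith
    simp only [Matrix.sub_mulVec, Matrix.one_mulVec, Matrix.smul_mulVec, Matrix.vecMulVec_mulVec]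
    ext i
    have hi : c * (v i * (v ⬝ᵥ u)) = v i := by rw [mul_left_comm, this, mul_one]
    simp only [Pi.sub_apply, Pi.smul_apply, MulOpposite.smul_eq_mul_unop, MulOpposite.unop_op,
      smul_eq_mul, hi]
    simp [hv]
  · simp only [Matrix.sub_mul, Matrix.one_mul, Matrix.smul_mul, Matrix.vecMulVec_mul]
    have : v ᵥ* X₀ = 0 := by rw [hv, Matrix.sub_vecMul, huX, hwX, sub_zero]
    rw [this]
    ext i j
    simp [vecMulVec_apply]

/-- The left kernel of an `n × p` matrix has dimension at least `n - p`. -/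
lemma exists_orthonormal_vecMul_eq_zero (X₀ : Matrix (Fin n) (Fin p) ℝ) :
    ∃ (m : ℕ) (w : Fin m → EuclideanSpace ℝ (Fin n)), n ≤ m + p ∧ Orthonormal ℝ w ∧
      ∀ k, (w k).ofLp ᵥ* X₀ = 0 := by
  let T : EuclideanSpace ℝ (Fin n) →ₗ[ℝ] (Fin p → ℝ) :=
    (Matrix.vecMulLinear X₀).comp (WithLp.linearEquiv 2 ℝ (Fin n → ℝ)).toLinearMap
  let b := stdOrthonormalBasis ℝ (LinearMap.ker T)
  refine ⟨Module.finrank ℝ (LinearMap.ker T), fun k => (b k : EuclideanSpace ℝ (Fin n)), ?_, ?_, ?_⟩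
  · have h1 := T.finrank_range_add_finrank_ker
    have h2 := (LinearMap.range T).finrank_le
    simp only [finrank_euclideanSpace, Fintype.card_fin, Module.finrank_fin_fun] at h1 h2
    omega
  · exact b.orthonormal.comp_linearIsometry (LinearMap.ker T).subtypeₗᵢ
  · intro k
    exact (b k).2

end LinearAlgebra

/-! ### The uniform distribution on the orthogonal group -/

section OrthogonalGroup

variable {n p : ℕ}

instance : SecondCountableTopology (Matrix.orthogonalGroup (Fin n) ℝ) :=
  haveI : SecondCountableTopology (Matrix (Fin n) (Fin n) ℝ) :=
    inferInstanceAs (SecondCountableTopology (Fin n → Fin n → ℝ))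
  TopologicalSpace.Subtype.secondCountableTopology _

instance : IsProbabilityMeasure (uniformOrthogonal n) :=
  ⟨by simpa [uniformOrthogonal] using
    Measure.haarMeasure_self (K₀ := (⊤ : TopologicalSpace.PositiveCompacts
      (Matrix.orthogonalGroup (Fin n) ℝ)))⟩

instance : (uniformOrthogonal n).IsHaarMeasure := by
  unfold uniformOrthogonal; infer_instance

/-- A compact group is unimodular. -/
instance : (uniformOrthogonal n).IsMulRightInvariant := by
  refine ⟨fun g => ?_⟩
  have : IsProbabilityMeasure ((uniformOrthogonal n).map (· * g)) :=
    Measure.isProbabilityMeasure_map (by fun_prop)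
  exact Measure.isHaarMeasure_eq_of_isProbabilityMeasure _ _

end OrthogonalGroup

/-! ### The Laplace transform of a uniform orthogonal matrix -/

section OrthogonalLaplace

variable {n p : ℕ}

/-- The Laplace transform of the uniform orthogonal matrix `A`, taken at `t` times the linear form
`A ↦ ⟨y, A X⟩`. -/
noncomputable def orthogonalLaplace (t : ℝ) (X y : Matrix (Fin n) (Fin p) ℝ) : ℝ≥0∞ :=
  ∫⁻ A, ENNReal.ofReal (Real.exp (t * frobInner y ((A : Matrix (Fin n) (Fin n) ℝ) * X)))
    ∂uniformOrthogonal n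

lemma continuous_frobInner {T : Type*} [TopologicalSpace T] {f g : T → Matrix (Fin n) (Fin p) ℝ}
    (hf : Continuous f) (hg : Continuous g) : Continuous fun x => frobInner (f x) (g x) := by
  unfold frobInner
  exact (hf.matrix_transpose.matrix_mul hg).matrix_trace

lemma continuous_orthogonal_mul (X : Matrix (Fin n) (Fin p) ℝ) :
    Continuous fun A : Matrix.orthogonalGroup (Fin n) ℝ => (A : Matrix (Fin n) (Fin n) ℝ) * X :=
  continuous_subtype_val.matrix_mul continuous_const

lemma measurable_exp_frobInner (t : ℝ) (X y : Matrix (Fin n) (Fin p) ℝ) :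
    Measurable fun A : Matrix.orthogonalGroup (Fin n) ℝ =>
      ENNReal.ofReal (Real.exp (t * frobInner y ((A : Matrix (Fin n) (Fin n) ℝ) * X))) :=
  ((Real.continuous_exp.comp (continuous_const.mul (continuous_frobInner continuous_const
    (continuous_orthogonal_mul X)))).measurable).ennreal_ofReal

lemma orthogonalLaplace_orthogonal_mul (t : ℝ) (X y : Matrix (Fin n) (Fin p) ℝ)
    (R : Matrix.orthogonalGroup (Fin n) ℝ) :
    orthogonalLaplace t ((R : Matrix (Fin n) (Fin n) ℝ) * X) y = orthogonalLaplace t X y := by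
  have h := lintegral_mul_right_eq_self (μ := uniformOrthogonal n) (fun A =>
    ENNReal.ofReal (Real.exp (t * frobInner y ((A : Matrix (Fin n) (Fin n) ℝ) * X)))) R
  simpa [orthogonalLaplace, Matrix.mul_assoc] using h

lemma orthogonalLaplace_add_vecMulVec (t : ℝ) (X₀ y : Matrix (Fin n) (Fin p) ℝ) (x : Fin p → ℝ)
    (u w : Fin n → ℝ) (hu : u ⬝ᵥ u = 1) (hw : w ⬝ᵥ w = 1) (huX : u ᵥ* X₀ = 0)
    (hwX : w ᵥ* X₀ = 0) :
    orthogonalLaplace t (X₀ + vecMulVec w x) y = orthogonalLaplace t (X₀ + vecMulVec u x) y := by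
  obtain ⟨R, hRu, hRX⟩ := exists_orthogonal_exchanging X₀ u w hu hw huX hwX
  rw [← orthogonalLaplace_orthogonal_mul t (X₀ + vecMulVec u x) y R, Matrix.mul_add,
    Matrix.mul_vecMulVec, hRu, hRX]

lemma transpose_mulVec_dotProduct_self_of_orthogonal (A : Matrix.orthogonalGroup (Fin n) ℝ)
    (v : Fin n → ℝ) :
    ((A : Matrix (Fin n) (Fin n) ℝ)ᵀ *ᵥ v) ⬝ᵥ ((A : Matrix (Fin n) (Fin n) ℝ)ᵀ *ᵥ v) = v ⬝ᵥ v := by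
  rw [Matrix.dotProduct_mulVec, Matrix.vecMul_transpose, Matrix.mulVec_mulVec,
    mul_transpose_self_of_orthogonal, Matrix.one_mulVec]

lemma mulVec_dotProduct_self_le (y : Matrix (Fin n) (Fin p) ℝ) (x : Fin p → ℝ) :
    (y *ᵥ x) ⬝ᵥ (y *ᵥ x) ≤ frobInner y y * (x ⬝ᵥ x) := by
  rw [frobInner_self_eq_sum, Finset.sum_mul]
  refine Finset.sum_le_sum fun i _ => ?_
  have h := Finset.sum_mul_sq_le_sq_mul_sq Finset.univ (y i) x
  simpa [Matrix.mulVec, dotProduct, sq] using h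

/-- Deleting a row does not increase the transform: replacing the row by its negative leaves the
transform unchanged, and `exp` is midpoint convex. -/
lemma orthogonalLaplace_le_add_vecMulVec (t : ℝ) (X₀ y : Matrix (Fin n) (Fin p) ℝ)
    (x : Fin p → ℝ) (u : Fin n → ℝ) (hu : u ⬝ᵥ u = 1) (huX : u ᵥ* X₀ = 0) :
    orthogonalLaplace t X₀ y ≤ orthogonalLaplace t (X₀ + vecMulVec u x) y := by
  have hneg := orthogonalLaplace_add_vecMulVec t X₀ y x u (-u) hu (by simpa using hu) huX
    (by rw [Matrix.neg_vecMul, huX, neg_zero])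
  have h2 : 2 * orthogonalLaplace t X₀ y ≤ 2 * orthogonalLaplace t (X₀ + vecMulVec u x) y := by
    rw [two_mul (orthogonalLaplace t (X₀ + _) y)]
    nth_rewrite 2 [← hneg]
    unfold orthogonalLaplace
    rw [← lintegral_const_mul _ (measurable_exp_frobInner t X₀ y),
      ← lintegral_add_left (measurable_exp_frobInner t _ y)]
    refine lintegral_mono fun A => ?_
    have h2' : (2 : ℝ≥0∞) = ENNReal.ofReal 2 := by simp
    rw [h2', ← ENNReal.ofReal_mul (by norm_num), ← ENNReal.ofReal_add (by positivity)
      (by positivity)]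
    refine ENNReal.ofReal_le_ofReal ?_
    simp only [Matrix.mul_add, frobInner_add_right, frobInner_mul_vecMulVec, dotProduct_neg,
      mul_add, Real.exp_add, mul_neg]
    set a := Real.exp (t * frobInner y ((A : Matrix (Fin n) (Fin n) ℝ) * X₀))
    have := Real.one_le_cosh (t * ((A : Matrix (Fin n) (Fin n) ℝ)ᵀ *ᵥ y *ᵥ x ⬝ᵥ u))
    rw [Real.cosh_eq] at this
    have ha : 0 < a := Real.exp_pos _
    nlinarith
  exact (ENNReal.mul_le_mul_iff_right (by norm_num) (by norm_num)).1 h2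

/-- Given the columns of `A` in the directions met by `X₀`, the vector `A u` is uniform on a sphere
of dimension at least `n - p - 1`, whose Laplace transform is dominated by that of a Gaussian
vector of variance `1 / (n - p)`. -/
lemma orthogonalLaplace_add_vecMulVec_le (hpn : p < n) (t : ℝ) (X₀ y : Matrix (Fin n) (Fin p) ℝ)
    (x : Fin p → ℝ) (u : Fin n → ℝ) (hu : u ⬝ᵥ u = 1) (huX : u ᵥ* X₀ = 0) :
    orthogonalLaplace t (X₀ + vecMulVec u x) y ≤
      ENNReal.ofReal (Real.exp (t ^ 2 * (frobInner y y * (x ⬝ᵥ x)) / (2 * ((n : ℝ) - p)))) *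
        orthogonalLaplace t X₀ y := by
  obtain ⟨m, w, hm, hw, hwX⟩ := exists_orthonormal_vecMul_eq_zero X₀
  have hm0 : 0 < m := by omega
  have hnp : (0 : ℝ) < n - p := sub_pos.2 (by exact_mod_cast hpn)
  have hnm : (n : ℝ) - p ≤ m := by
    have : (n : ℝ) ≤ m + p := by exact_mod_cast hm
    linarith
  have hs : ∀ s : Fin m → Bool,
      orthogonalLaplace t (X₀ + vecMulVec (signVector w s).ofLp x) y =
        orthogonalLaplace t (X₀ + vecMulVec u x) y := by
    intro s
    refine orthogonalLaplace_add_vecMulVec t X₀ y x u _ hu ?_ huX ?_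
    · have := norm_signVector hw hm0 s
      have h' := EuclideanSpace.real_norm_sq_eq (signVector w s)
      rw [this] at h'
      simp only [dotProduct, ← sq]
      linarith
    · simp only [signVector, WithLp.ofLp_sum, WithLp.ofLp_smul, Matrix.sum_vecMul,
        Matrix.smul_vecMul, hwX, smul_zero, Finset.sum_const_zero]
  -- All sign vectors give the same transform, so the sum over the signs can be taken inside.
  have key : (2 ^ m : ℝ≥0∞) * orthogonalLaplace t (X₀ + vecMulVec u x) y ≤
      2 ^ m * (ENNReal.ofReal (Real.exp (t ^ 2 * (frobInner y y * (x ⬝ᵥ x)) /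
        (2 * ((n : ℝ) - p)))) * orthogonalLaplace t X₀ y) := by
    have hsum : (2 ^ m : ℝ≥0∞) * orthogonalLaplace t (X₀ + vecMulVec u x) y =
        ∑ s : Fin m → Bool, orthogonalLaplace t (X₀ + vecMulVec (signVector w s).ofLp x) y := by
      simp [hs]
    rw [hsum]
    unfold orthogonalLaplace
    rw [← lintegral_finsetSum _ (fun s _ => measurable_exp_frobInner t _ y), ← mul_assoc,
      ← lintegral_const_mul _ (measurable_exp_frobInner t X₀ y)]
    refine lintegral_mono fun A => ?_
    have h2' : (2 ^ m : ℝ≥0∞) = ENNReal.ofReal (2 ^ m) := by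
      rw [ENNReal.ofReal_pow (by norm_num)]; simp
    rw [h2', ← ENNReal.ofReal_mul (by positivity), ← ENNReal.ofReal_mul (by positivity),
      ← ENNReal.ofReal_sum_of_nonneg fun _ _ => (Real.exp_pos _).le]
    refine ENNReal.ofReal_le_ofReal ?_
    simp only [Matrix.mul_add, frobInner_add_right, frobInner_mul_vecMulVec, mul_add,
      Real.exp_add, ← Finset.mul_sum]
    rw [mul_comm]
    gcongr
    set v : Fin n → ℝ := (A : Matrix (Fin n) (Fin n) ℝ)ᵀ *ᵥ y *ᵥ x with hv
    have hvn : ‖WithLp.toLp 2 (t • v)‖ ^ 2 ≤ t ^ 2 * (frobInner y y * (x ⬝ᵥ x)) := by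
      have h1 : ‖WithLp.toLp 2 (t • v)‖ ^ 2 = t ^ 2 * (v ⬝ᵥ v) := by
        rw [EuclideanSpace.real_norm_sq_eq]
        simp only [Pi.smul_apply, smul_eq_mul, dotProduct, Finset.mul_sum]
        exact Finset.sum_congr rfl fun i _ => by ring
      rw [h1, hv, transpose_mulVec_dotProduct_self_of_orthogonal]
      gcongr
      exact mulVec_dotProduct_self_le y x
    have h := sum_exp_inner_signVector_le hw (WithLp.toLp 2 (t • v))
    have hin : ∀ s : Fin m → Bool, inner ℝ (WithLp.toLp 2 (t • v)) (signVector w s) =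
        t * (v ⬝ᵥ (signVector w s).ofLp) := by
      intro s
      simp only [PiLp.inner_apply, Pi.smul_apply, smul_eq_mul, dotProduct, Finset.mul_sum,
        RCLike.inner_apply, conj_trivial]
      exact Finset.sum_congr rfl fun i _ => by ring
    simp only [hin] at h
    have h0 : 0 ≤ t ^ 2 * (frobInner y y * (x ⬝ᵥ x)) := (sq_nonneg _).trans hvn
    refine h.trans ?_
    gcongr
  exact (ENNReal.mul_le_mul_iff_right (by positivity) (by simp)).1 key

/-- Comparison of the transforms of two matrices that differ in one row: both are compared with the
transform of the matrix in which that row is deleted. -/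
lemma orthogonalLaplace_le_of_eq_off_row (hpn : p < n) (t : ℝ) (X X' y : Matrix (Fin n) (Fin p) ℝ)
    (i : Fin n) (h : ∀ k, k ≠ i → ∀ j, X k j = X' k j) :
    orthogonalLaplace t X y ≤
      ENNReal.ofReal (Real.exp (t ^ 2 * (frobInner y y * (X i ⬝ᵥ X i)) / (2 * ((n : ℝ) - p)))) *
        orthogonalLaplace t X' y := by
  set X₀ := X.updateRow i 0 with hX₀
  have hdec : ∀ Z : Matrix (Fin n) (Fin p) ℝ, (∀ k, k ≠ i → ∀ j, X k j = Z k j) →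
      Z = X₀ + vecMulVec (Pi.single i 1) (Z i) := by
    intro Z hZ
    ext k j
    by_cases hk : k = i
    · subst hk; simp [hX₀, vecMulVec_apply]
    · simp [hX₀, vecMulVec_apply, hk, hZ k hk j]
  have hu : (Pi.single i 1 : Fin n → ℝ) ⬝ᵥ Pi.single i 1 = 1 := by simp
  have huX : (Pi.single i 1 : Fin n → ℝ) ᵥ* X₀ = 0 := by
    ext j; simp [hX₀]
  calc orthogonalLaplace t X y
      = orthogonalLaplace t (X₀ + vecMulVec (Pi.single i 1) (X i)) y := by
        rw [← hdec X fun _ _ _ => rfl]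
    _ ≤ _ := orthogonalLaplace_add_vecMulVec_le hpn t X₀ y (X i) _ hu huX
    _ ≤ _ := by
        gcongr
        conv_rhs => rw [hdec X' h]
        exact orthogonalLaplace_le_add_vecMulVec t X₀ y (X' i) _ hu huX

end OrthogonalLaplace

/-! ### Finite products of measures with densities -/

section PiDensity

lemma lintegral_fin_prod_eq_prod {k : ℕ} {E : Type*} [MeasurableSpace E] (μ : Fin k → Measure E)
    [∀ i, SigmaFinite (μ i)] (f : Fin k → E → ℝ≥0∞) (hf : ∀ i, Measurable (f i)) :
    ∫⁻ x, ∏ i, f i (x i) ∂(Measure.pi μ) = ∏ i, ∫⁻ x, f i x ∂(μ i) := by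
  induction k with
  | zero => simp
  | succ k ih =>
    have hm : Measurable fun x : Fin (k + 1) → E => ∏ i, f i (x i) :=
      Finset.measurable_fun_prod _ fun i _ => (hf i).comp (measurable_pi_apply i)
    rw [← ((measurePreserving_piFinSuccAbove μ 0).symm).lintegral_comp hm]
    simp_rw [MeasurableEquiv.piFinSuccAbove_symm_apply, Fin.insertNthEquiv, Fin.prod_univ_succ,
      Fin.insertNth_zero, Equiv.coe_fn_mk, Fin.cons_succ, Fin.zero_succAbove, cast_eq,
      Fin.cons_zero]
    have hm' : Measurable fun x : Fin k → E => ∏ i, f i.succ (x i) :=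
      Finset.measurable_fun_prod _ fun i _ => (hf i.succ).comp (measurable_pi_apply i)
    rw [← ih _ _ fun i => hf i.succ]
    exact lintegral_prod_mul (hf 0).aemeasurable hm'.aemeasurable

lemma pi_withDensity_fin {k : ℕ} {E : Type*} [MeasurableSpace E] (μ : Fin k → Measure E)
    [∀ i, SigmaFinite (μ i)] (f : Fin k → E → ℝ≥0∞) (hf : ∀ i, Measurable (f i))
    [∀ i, SigmaFinite ((μ i).withDensity (f i))] :
    Measure.pi (fun i => (μ i).withDensity (f i)) =
      (Measure.pi μ).withDensity fun x => ∏ i, f i (x i) := by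
  refine Measure.pi_eq fun s hs => ?_
  rw [withDensity_apply _ (MeasurableSet.univ_pi hs),
    ← lintegral_indicator (MeasurableSet.univ_pi hs)]
  have h : (Set.univ.pi s).indicator (fun x => ∏ i, f i (x i)) =
      fun x => ∏ i, (s i).indicator (f i) (x i) := by
    ext x
    by_cases hx : x ∈ Set.univ.pi s
    · rw [Set.indicator_of_mem hx]
      exact Finset.prod_congr rfl fun i _ => (Set.indicator_of_mem (hx i trivial) _).symm
    · rw [Set.indicator_of_notMem hx]
      obtain ⟨i, hi⟩ : ∃ i, x i ∉ s i := by simpa [Set.mem_pi] using hx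
      exact (Finset.prod_eq_zero (Finset.mem_univ i) (Set.indicator_of_notMem hi _)).symm
  rw [h, lintegral_fin_prod_eq_prod _ _ fun i => (hf i).indicator (hs i)]
  refine Finset.prod_congr rfl fun i _ => ?_
  rw [lintegral_indicator (hs i), withDensity_apply _ (hs i)]

end PiDensity

/-! ### Gaussian matrices -/

section GaussianMatrix

variable {n p : ℕ}

lemma lebesgueMatrix_eq_pi (n p : ℕ) : lebesgueMatrix n p =
    (Measure.pi fun _ : Fin n => Measure.pi fun _ : Fin p => (volume : Measure ℝ)) :=
  Measure.map_id

lemma gaussianNoise_eq_pi (n p : ℕ) (σ : ℝ) : gaussianNoise n p σ =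
    (Measure.pi fun _ : Fin n => Measure.pi fun _ : Fin p =>
      gaussianReal 0 (σ ^ 2).toNNReal) :=
  Measure.map_id

instance : IsProbabilityMeasure (gaussianNoise n p σ) := by
  rw [gaussianNoise_eq_pi]
  exact inferInstanceAs (IsProbabilityMeasure (Measure.pi fun _ : Fin n =>
    Measure.pi fun _ : Fin p => gaussianReal 0 (σ ^ 2).toNNReal))

instance : SecondCountableTopology (Matrix (Fin n) (Fin p) ℝ) :=
  inferInstanceAs (SecondCountableTopology (Fin n → Fin p → ℝ))

instance : LocallyCompactSpace (Matrix (Fin n) (Fin p) ℝ) :=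
  inferInstanceAs (LocallyCompactSpace (Fin n → Fin p → ℝ))

instance : (lebesgueMatrix n p).IsAddHaarMeasure := by
  rw [lebesgueMatrix_eq_pi]
  have : (Measure.pi fun _ : Fin p => (volume : Measure ℝ)).IsAddHaarMeasure := inferInstance
  exact Measure.pi.isAddHaarMeasure fun _ : Fin n => Measure.pi fun _ : Fin p =>
    (volume : Measure ℝ)

/-- The density of the Gaussian matrix with independent `N(0, σ²)` entries. -/
noncomputable def gaussianMatrixPDF (σ : ℝ) (c : Matrix (Fin n) (Fin p) ℝ) : ℝ≥0∞ :=
  ENNReal.ofReal ((√(2 * Real.pi * σ ^ 2))⁻¹ ^ (n * p) *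
    Real.exp (-frobInner c c / (2 * σ ^ 2)))

lemma continuous_gaussianMatrixPDF (σ : ℝ) :
    Continuous (gaussianMatrixPDF σ : Matrix (Fin n) (Fin p) ℝ → ℝ≥0∞) :=
  ENNReal.continuous_ofReal.comp (continuous_const.mul (Real.continuous_exp.comp
    ((continuous_frobInner continuous_id continuous_id).neg.div_const _)))

lemma gaussianMatrixPDF_orthogonal_mul (σ : ℝ) (A : Matrix.orthogonalGroup (Fin n) ℝ)
    (c : Matrix (Fin n) (Fin p) ℝ) :
    gaussianMatrixPDF σ ((A : Matrix (Fin n) (Fin n) ℝ) * c) = gaussianMatrixPDF σ c := by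
  rw [gaussianMatrixPDF, frobInner_orthogonal_mul, gaussianMatrixPDF]

lemma prod_gaussianPDF_eq {σ : ℝ} (hσ : 0 < σ) (c : Matrix (Fin n) (Fin p) ℝ) :
    ∏ i, ∏ j, gaussianPDF 0 (σ ^ 2).toNNReal (c i j) = gaussianMatrixPDF σ c := by
  have hσ2 : 0 < σ ^ 2 := by positivity
  simp only [gaussianPDF, gaussianPDFReal, gaussianMatrixPDF, sub_zero,
    Real.coe_toNNReal _ hσ2.le]
  have h : ∀ i, ∏ j, ENNReal.ofReal ((√(2 * Real.pi * σ ^ 2))⁻¹ *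
      Real.exp (-c i j ^ 2 / (2 * σ ^ 2))) = ENNReal.ofReal (∏ j, (√(2 * Real.pi * σ ^ 2))⁻¹ *
      Real.exp (-c i j ^ 2 / (2 * σ ^ 2))) := fun i =>
    (ENNReal.ofReal_prod_of_nonneg fun j _ => by positivity).symm
  simp_rw [h]
  rw [← ENNReal.ofReal_prod_of_nonneg fun i _ => Finset.prod_nonneg fun j _ => by positivity]
  simp_rw [Finset.prod_mul_distrib, ← Real.exp_sum]
  simp only [Finset.prod_const, Finset.card_univ, Fintype.card_fin, ← pow_mul,
    ← Finset.sum_div, Finset.sum_neg_distrib, frobInner_self_eq_sum, mul_comm p n]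

lemma gaussianNoise_eq_withDensity (n p : ℕ) {σ : ℝ} (hσ : 0 < σ) :
    gaussianNoise n p σ = (lebesgueMatrix n p).withDensity (gaussianMatrixPDF σ) := by
  have hσ2 : 0 < σ ^ 2 := by positivity
  have hv : (σ ^ 2).toNNReal ≠ 0 := by simpa using hσ.ne'
  rw [gaussianNoise_eq_pi, lebesgueMatrix_eq_pi]
  have h1 : (Measure.pi fun _ : Fin p => gaussianReal 0 (σ ^ 2).toNNReal) =
      (Measure.pi fun _ : Fin p => (volume : Measure ℝ)).withDensity
        fun x => ∏ j, gaussianPDF 0 (σ ^ 2).toNNReal (x j) := by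
    have : SigmaFinite ((volume : Measure ℝ).withDensity
        (gaussianPDF 0 (σ ^ 2).toNNReal)) := by
      rw [← gaussianReal_of_var_ne_zero 0 hv]; infer_instance
    rw [← pi_withDensity_fin _ _ fun _ => measurable_gaussianPDF _ _]
    simp_rw [gaussianReal_of_var_ne_zero 0 hv]
  have h2 : (Measure.pi fun _ : Fin n => Measure.pi fun _ : Fin p =>
        gaussianReal 0 (σ ^ 2).toNNReal) =
      (Measure.pi fun _ : Fin n => Measure.pi fun _ : Fin p => (volume : Measure ℝ)).withDensity
        fun x => ∏ i, ∏ j, gaussianPDF 0 (σ ^ 2).toNNReal (x i j) := by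
    have : SigmaFinite ((Measure.pi fun _ : Fin p => (volume : Measure ℝ)).withDensity
        fun x => ∏ j, gaussianPDF 0 (σ ^ 2).toNNReal (x j)) := by
      rw [← h1]; infer_instance
    rw [h1]
    exact pi_withDensity_fin (fun _ : Fin n => Measure.pi fun _ : Fin p => (volume : Measure ℝ))
      (fun _ x => ∏ j, gaussianPDF 0 (σ ^ 2).toNNReal (x j)) fun _ =>
        Finset.measurable_fun_prod _ fun j _ =>
          (measurable_gaussianPDF _ _).comp (measurable_pi_apply j)
  exact h2.trans (congrArg _ (funext fun x => prod_gaussianPDF_eq hσ x))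

/-- Left multiplication by an orthogonal matrix scales Lebesgue measure by a constant; the
constant is one because the standard Gaussian density, of total mass one, is invariant. -/
lemma measurePreserving_orthogonal_mul (A : Matrix.orthogonalGroup (Fin n) ℝ) :
    MeasurePreserving (fun c : Matrix (Fin n) (Fin p) ℝ => (A : Matrix (Fin n) (Fin n) ℝ) * c)
      (lebesgueMatrix n p) (lebesgueMatrix n p) := by
  have hcont : ∀ B : Matrix (Fin n) (Fin n) ℝ,
      Continuous fun c : Matrix (Fin n) (Fin p) ℝ => B * c :=
    fun B => continuous_const.matrix_mul continuous_id
  refine ⟨(hcont A).measurable, ?_⟩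
  let e : Matrix (Fin n) (Fin p) ℝ ≃+ Matrix (Fin n) (Fin p) ℝ :=
    { toFun := fun c => (A : Matrix (Fin n) (Fin n) ℝ) * c
      invFun := fun c => (A : Matrix (Fin n) (Fin n) ℝ)ᵀ * c
      left_inv := fun c => by
        simp [← Matrix.mul_assoc, transpose_mul_self_of_orthogonal]
      right_inv := fun c => by
        simp [← Matrix.mul_assoc, mul_transpose_self_of_orthogonal]
      map_add' := fun c d => Matrix.mul_add _ _ _ }
  have : (Measure.map e (lebesgueMatrix n p)).IsAddHaarMeasure :=
    e.isAddHaarMeasure_map _ (hcont _) (hcont _)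
  have hscale := Measure.isAddLeftInvariant_eq_smul (Measure.map e (lebesgueMatrix n p))
    (lebesgueMatrix n p)
  set κ := Measure.addHaarScalarFactor (Measure.map e (lebesgueMatrix n p)) (lebesgueMatrix n p)
  have hmeas : Measurable (gaussianMatrixPDF 1 : Matrix (Fin n) (Fin p) ℝ → ℝ≥0∞) :=
    (continuous_gaussianMatrixPDF 1).measurable
  have hone : ∫⁻ c, gaussianMatrixPDF 1 c ∂(lebesgueMatrix n p) = 1 := by
    rw [← setLIntegral_univ, ← withDensity_apply _ MeasurableSet.univ,
      ← gaussianNoise_eq_withDensity n p one_pos, measure_univ]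
  have h1 : ∫⁻ c, gaussianMatrixPDF 1 c ∂(Measure.map e (lebesgueMatrix n p)) = 1 := by
    rw [lintegral_map hmeas (show Measurable e from (hcont A).measurable)]
    simp only [e, AddEquiv.coe_mk, Equiv.coe_fn_mk, gaussianMatrixPDF_orthogonal_mul, hone]
  rw [hscale, lintegral_smul_measure, hone] at h1
  have hκ : κ = 1 := by simpa [ENNReal.smul_def] using h1
  rw [hκ, one_smul] at hscale
  exact hscale

end GaussianMatrix

/-! ### The chi-square quantile -/

section ChiSquare

variable {n p : ℕ}

/-- The infimum defining the upper quantile is attained, by right continuity of the distribution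
function. -/
lemma measure_Ioi_upperQuantile_le (ν : Measure ℝ) [IsProbabilityMeasure ν] {δ : ℝ} (hδ0 : 0 < δ)
    (hδ1 : δ < 1) : ν (Set.Ioi (upperQuantile ν δ)) ≤ ENNReal.ofReal δ := by
  have hiff : ∀ t, ν (Set.Ioi t) ≤ ENNReal.ofReal δ ↔ 1 - δ ≤ cdf ν t := by
    intro t
    have h1 : ν (Set.Ioi t) = ENNReal.ofReal (1 - cdf ν t) := by
      rw [← Set.compl_Iic, prob_compl_eq_one_sub measurableSet_Iic,
        ENNReal.ofReal_sub _ (cdf_nonneg ν t), ENNReal.ofReal_one, ofReal_cdf]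
    rw [h1, ENNReal.ofReal_le_ofReal_iff hδ0.le]
    constructor <;> intro h <;> linarith
  have hbdd : BddBelow {t : ℝ | ν (Set.Ioi t) ≤ ENNReal.ofReal δ} := by
    obtain ⟨a, ha⟩ := ((tendsto_cdf_atBot ν).eventually_lt_const
      (show (0 : ℝ) < 1 - δ by linarith)).exists
    refine ⟨a, fun t ht => ?_⟩
    by_contra! hlt
    have := (hiff t).1 ht
    have := monotone_cdf ν hlt.le
    linarith
  have hne : {t : ℝ | ν (Set.Ioi t) ≤ ENNReal.ofReal δ}.Nonempty := by
    obtain ⟨a, ha⟩ := ((tendsto_cdf_atTop ν).eventually_const_lt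
      (show 1 - δ < (1 : ℝ) by linarith)).exists
    exact ⟨a, (hiff a).2 ha.le⟩
  rw [hiff]
  have hright := ((cdf ν).right_continuous (upperQuantile ν δ)).mono_left
    (nhdsWithin_mono _ Set.Ioi_subset_Ici_self)
  refine ge_of_tendsto hright ?_
  filter_upwards [self_mem_nhdsWithin] with t ht
  obtain ⟨u, hu, hut⟩ := (csInf_lt_iff hbdd hne).1 (show upperQuantile ν δ < t from ht)
  exact ((hiff u).1 hu).trans (monotone_cdf ν hut.le)

instance (k : ℕ) : IsProbabilityMeasure (chiSquare k) :=
  Measure.isProbabilityMeasure_map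
    (show Measurable fun z : Fin k → ℝ => ∑ i, z i ^ 2 by fun_prop).aemeasurable

/-- A Gaussian matrix is a rearrangement of `σ` times a standard Gaussian vector. -/
lemma gaussianNoise_eq_map (n p : ℕ) (σ : ℝ) :
    gaussianNoise n p σ = Measure.map (fun (z : Fin (n * p) → ℝ) =>
      (Matrix.of fun i j => σ * z (finProdFinEquiv (i, j)) : Matrix (Fin n) (Fin p) ℝ))
      (Measure.pi fun _ => gaussianReal 0 1) := by
  have hg : gaussianReal 0 (σ ^ 2).toNNReal = (gaussianReal 0 1).map (σ * ·) := by
    rw [gaussianReal_map_const_mul, mul_zero, mul_one]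
    congr 1
    ext
    simp [sq_nonneg]
  have h1 : (Measure.pi fun _ : Fin (n * p) => gaussianReal 0 (σ ^ 2).toNNReal) =
      Measure.map (fun z k => σ * z k) (Measure.pi fun _ : Fin (n * p) => gaussianReal 0 1) := by
    rw [Measure.pi_map_pi (f := fun _ : Fin (n * p) => fun x : ℝ => σ * x) (by fun_prop), hg]
  have h2 := (measurePreserving_arrowCongr' (fun _ : Fin n × Fin p =>
    gaussianReal 0 (σ ^ 2).toNNReal) (fun _ : Fin (n * p) => gaussianReal 0 (σ ^ 2).toNNReal)
    finProdFinEquiv (MeasurableEquiv.refl ℝ) fun _ => MeasurePreserving.id _).symm.map_eq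
  have h3 := Measure.infinitePi_map_curry (ι := Fin n) (κ := Fin p)
    (fun _ _ => gaussianReal 0 (σ ^ 2).toNNReal)
  simp only [Measure.infinitePi_eq_pi] at h3
  rw [gaussianNoise_eq_pi, ← h3, ← h2, h1, Measure.map_map (by fun_prop) (by fun_prop),
    Measure.map_map (by fun_prop) (by fun_prop)]
  rfl

lemma gaussianNoise_frobInner_gt_le (n p : ℕ) {σ δ : ℝ} (hσ : 0 < σ) (hδ0 : 0 < δ) (hδ1 : δ < 1) :
    gaussianNoise n p σ {c | σ ^ 2 * upperQuantile (chiSquare (n * p)) δ < frobInner c c} ≤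
      ENNReal.ofReal δ := by
  refine le_trans (le_of_eq ?_) (measure_Ioi_upperQuantile_le (chiSquare (n * p)) hδ0 hδ1)
  have hm1 : Measurable fun (z : Fin (n * p) → ℝ) =>
      (Matrix.of fun i j => σ * z (finProdFinEquiv (i, j)) : Matrix (Fin n) (Fin p) ℝ) :=
    measurable_pi_lambda _ fun i => measurable_pi_lambda _ fun j => by
      simp only [Matrix.of_apply]; fun_prop
  have hm2 : MeasurableSet {c : Matrix (Fin n) (Fin p) ℝ |
      σ ^ 2 * upperQuantile (chiSquare (n * p)) δ < frobInner c c} :=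
    (isOpen_lt continuous_const (continuous_frobInner continuous_id continuous_id)).measurableSet
  rw [gaussianNoise_eq_map, Measure.map_apply hm1 hm2, chiSquare,
    Measure.map_apply (by fun_prop) measurableSet_Ioi]
  congr 1
  ext z
  have hsum : frobInner (Matrix.of fun (i : Fin n) (j : Fin p) => σ * z (finProdFinEquiv (i, j)))
      (Matrix.of fun i j => σ * z (finProdFinEquiv (i, j))) = σ ^ 2 * ∑ k, z k ^ 2 := by
    rw [frobInner_self_eq_sum, ← finProdFinEquiv.sum_comp, Fintype.sum_prod_type, Finset.mul_sum]
    simp only [Matrix.of_apply, mul_pow, Finset.mul_sum]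
  simp only [Set.mem_preimage, Set.mem_ofPred_eq, hsum, Set.mem_Ioi]
  exact mul_lt_mul_iff_right₀ (by positivity)

end ChiSquare

/-! ### The density of the release mechanisms -/

section MechanismDensity

variable {n p : ℕ}

/-- The density of the released matrix: the Gaussian density centred at `A X`, averaged over the
uniform orthogonal matrix `A`. -/
noncomputable def mechanismDensity (σ : ℝ) (X y : Matrix (Fin n) (Fin p) ℝ) : ℝ≥0∞ :=
  ∫⁻ A, gaussianMatrixPDF σ (y - (A : Matrix (Fin n) (Fin n) ℝ) * X) ∂uniformOrthogonal n

lemma measurable_gaussianMatrixPDF_sub (σ : ℝ) (X : Matrix (Fin n) (Fin p) ℝ) :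
    Measurable fun q : Matrix.orthogonalGroup (Fin n) ℝ × Matrix (Fin n) (Fin p) ℝ =>
      gaussianMatrixPDF σ (q.2 - (q.1 : Matrix (Fin n) (Fin n) ℝ) * X) :=
  ((continuous_gaussianMatrixPDF σ).comp (continuous_snd.sub
    ((continuous_orthogonal_mul X).comp continuous_fst))).measurable

lemma measurable_mechanismDensity (σ : ℝ) (X : Matrix (Fin n) (Fin p) ℝ) :
    Measurable (mechanismDensity σ X) :=
  (measurable_gaussianMatrixPDF_sub σ X).lintegral_prod_left'

lemma mechanismDensity_eq_mul_orthogonalLaplace (σ : ℝ) (X y : Matrix (Fin n) (Fin p) ℝ) :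
    mechanismDensity σ X y = ENNReal.ofReal ((√(2 * Real.pi * σ ^ 2))⁻¹ ^ (n * p) *
      Real.exp (-(frobInner y y + frobInner X X) / (2 * σ ^ 2))) *
        orthogonalLaplace (1 / σ ^ 2) X y := by
  rw [orthogonalLaplace, ← lintegral_const_mul _ (measurable_exp_frobInner _ X y),
    mechanismDensity]
  refine lintegral_congr fun A => ?_
  rw [gaussianMatrixPDF, ← ENNReal.ofReal_mul (by positivity), frobInner_sub_self,
    frobInner_orthogonal_mul, mul_assoc (_ ^ (n * p)), ← Real.exp_add]
  congr 3
  ring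

lemma map_withDensity_of_measurePreserving {E : Type*} [MeasurableSpace E] {μ : Measure E}
    {e : E → E} (he : MeasurePreserving e μ μ) {φ ψ : E → ℝ≥0∞} (hψ : Measurable ψ)
    (h : ∀ c, ψ (e c) = φ c) : Measure.map e (μ.withDensity φ) = μ.withDensity ψ := by
  ext S hS
  rw [Measure.map_apply he.measurable hS, withDensity_apply _ (he.measurable hS),
    withDensity_apply _ hS, ← he.setLIntegral_comp_preimage hS hψ]
  simp_rw [h]

/-- Fubini: a release mechanism whose conditional law given `A` is Gaussian with mean `A X` has the
averaged density. -/
lemma map_prod_eq_withDensity_mechanismDensity {σ : ℝ} (hσ : 0 < σ) (X : Matrix (Fin n) (Fin p) ℝ)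
    (T : Matrix.orthogonalGroup (Fin n) ℝ × Matrix (Fin n) (Fin p) ℝ → Matrix (Fin n) (Fin p) ℝ)
    (hT : Measurable T)
    (hpres : ∀ A, MeasurePreserving (fun c => T (A, c)) (lebesgueMatrix n p) (lebesgueMatrix n p))
    (hdens : ∀ A c, gaussianMatrixPDF σ (T (A, c) - (A : Matrix (Fin n) (Fin n) ℝ) * X) =
      gaussianMatrixPDF σ c) :
    Measure.map T ((uniformOrthogonal n).prod (gaussianNoise n p σ)) =
      (lebesgueMatrix n p).withDensity (mechanismDensity σ X) := by
  ext S hS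
  rw [Measure.map_apply hT hS, Measure.prod_apply (hT hS), withDensity_apply _ hS]
  have h : ∀ A, gaussianNoise n p σ (Prod.mk A ⁻¹' (T ⁻¹' S)) =
      ∫⁻ y in S, gaussianMatrixPDF σ (y - (A : Matrix (Fin n) (Fin n) ℝ) * X)
        ∂lebesgueMatrix n p := by
    intro A
    have hm : Measurable fun y : Matrix (Fin n) (Fin p) ℝ =>
        gaussianMatrixPDF σ (y - (A : Matrix (Fin n) (Fin n) ℝ) * X) :=
      ((continuous_gaussianMatrixPDF σ).comp (continuous_id.sub continuous_const)).measurable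
    have hmap := map_withDensity_of_measurePreserving (hpres A) hm (hdens A)
    rw [← gaussianNoise_eq_withDensity n p hσ] at hmap
    rw [← withDensity_apply _ hS, ← hmap, Measure.map_apply (hpres A).measurable hS,
      Set.preimage_preimage]
  simp_rw [h, mechanismDensity]
  exact lintegral_lintegral_swap (measurable_gaussianMatrixPDF_sub σ X).aemeasurable

end MechanismDensity

/-! ### Comparison of the densities of neighbouring data sets -/

section Comparison

variable {n p : ℕ}

lemma IsDataSet.sum_sq_row_le {X : Matrix (Fin n) (Fin p) ℝ} (hX : IsDataSet X) (i : Fin n) :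
    X i ⬝ᵥ X i ≤ p := by
  have h : ∀ j ∈ (Finset.univ : Finset (Fin p)), X i j * X i j ≤ 1 := fun j _ => by
    rw [← sq, sq_le_one_iff_abs_le_one]; exact hX i j
  simpa [dotProduct] using Finset.sum_le_sum h

lemma IsDataSet.frobInner_self_le {X : Matrix (Fin n) (Fin p) ℝ} (hX : IsDataSet X) :
    frobInner X X ≤ n * p := by
  rw [frobInner_eq_sum]
  have h : ∀ i ∈ (Finset.univ : Finset (Fin n)), ∑ j, X i j * X i j ≤ (p : ℝ) :=
    fun i _ => hX.sum_sq_row_le i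
  simpa using Finset.sum_le_sum h

/-- Only the differing row contributes, and there `‖x'‖² - ‖x‖² = ⟨x' - x, x' + x⟩`. -/
lemma IsNeighbor.frobInner_self_sub_le {X X' : Matrix (Fin n) (Fin p) ℝ} (hX : IsDataSet X)
    (hX' : IsDataSet X') (h : IsNeighbor X X') :
    frobInner X' X' - frobInner X X ≤ 2 * √p := by
  obtain ⟨hnorm, i, hi⟩ := h
  have hrow : ∀ k, k ≠ i → X k = X' k := fun k hk => funext (hi k hk)
  have hdiff : frobInner X' X' - frobInner X X =
      ∑ j, (X i j - X' i j) * (-(X i j + X' i j)) := by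
    rw [frobInner_eq_sum, frobInner_eq_sum, ← Finset.sum_sub_distrib, Finset.sum_eq_single i
      (fun k _ hk => by rw [hrow k hk, sub_self]) (by simp), ← Finset.sum_sub_distrib]
    exact Finset.sum_congr rfl fun j _ => by ring
  have h1 : ∑ j, (X i j - X' i j) ^ 2 ≤ 1 := by
    have h2 : ∑ k, ∑ j, (X - X') k j ^ 2 ≤ 1 := by
      simpa using (Real.sqrt_le_left (by norm_num)).1 hnorm
    refine le_trans ?_ h2
    exact Finset.single_le_sum (f := fun k => ∑ j, (X - X') k j ^ 2)
      (fun k _ => Finset.sum_nonneg fun j _ => sq_nonneg _) (Finset.mem_univ i)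
  have h2 : ∑ j, (-(X i j + X' i j)) ^ 2 ≤ 4 * p := by
    have : ∀ j ∈ (Finset.univ : Finset (Fin p)), (-(X i j + X' i j)) ^ 2 ≤ 4 := fun j _ => by
      have := abs_le.1 (hX i j)
      have := abs_le.1 (hX' i j)
      nlinarith
    simpa [mul_comm] using Finset.sum_le_sum this
  rw [hdiff]
  have hcs := Finset.sum_mul_sq_le_sq_mul_sq Finset.univ (fun j => X i j - X' i j)
    (fun j => -(X i j + X' i j))
  have h3 : (∑ j, (X i j - X' i j) * (-(X i j + X' i j))) ^ 2 ≤ 4 * p := by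
    have h0 : 0 ≤ ∑ j, (-(X i j + X' i j)) ^ 2 := Finset.sum_nonneg fun j _ => sq_nonneg _
    nlinarith
  have h4 := Real.le_sqrt_of_sq_le h3
  rwa [Real.sqrt_mul (by norm_num), show √(4 : ℝ) = 2 by
    rw [show (4 : ℝ) = 2 ^ 2 by norm_num, Real.sqrt_sq (by norm_num)]] at h4

/-- The density ratio of neighbouring data sets, controlled by the size of the output `y`. -/
lemma mechanismDensity_le_of_isNeighbor (hpn : p < n) {σ ε : ℝ} (hσ : 0 < σ)
    {X X' : Matrix (Fin n) (Fin p) ℝ} (hX : IsDataSet X) (hX' : IsDataSet X')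
    (h : IsNeighbor X X') (y : Matrix (Fin n) (Fin p) ℝ)
    (hy : √p / σ ^ 2 + p * frobInner y y / (2 * ((n : ℝ) - p) * σ ^ 4) ≤ ε) :
    mechanismDensity σ X y ≤ ENNReal.ofReal (Real.exp ε) * mechanismDensity σ X' y := by
  have hdiff := h.frobInner_self_sub_le hX hX'
  obtain ⟨-, i, hi⟩ := h
  have hnp : (0 : ℝ) < n - p := sub_pos.2 (by exact_mod_cast hpn)
  rw [mechanismDensity_eq_mul_orthogonalLaplace, mechanismDensity_eq_mul_orthogonalLaplace,
    ← mul_assoc, ← ENNReal.ofReal_mul (by positivity)]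
  refine (mul_le_mul_right (orthogonalLaplace_le_of_eq_off_row hpn _ X X' y i hi) _).trans ?_
  rw [← mul_assoc, ← ENNReal.ofReal_mul (by positivity)]
  refine mul_le_mul_left (ENNReal.ofReal_le_ofReal ?_) _
  rw [mul_left_comm (Real.exp ε), mul_assoc (_ ^ (n * p)), ← Real.exp_add, ← Real.exp_add]
  refine mul_le_mul_of_nonneg_left (Real.exp_le_exp.2 ?_) (by positivity)
  have h1 : (1 / σ ^ 2) ^ 2 * (frobInner y y * (X i ⬝ᵥ X i)) / (2 * ((n : ℝ) - p)) ≤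
      p * frobInner y y / (2 * ((n : ℝ) - p) * σ ^ 4) := by
    have : (1 / σ ^ 2) ^ 2 * (frobInner y y * (X i ⬝ᵥ X i)) / (2 * ((n : ℝ) - p)) =
      (X i ⬝ᵥ X i) * frobInner y y / (2 * ((n : ℝ) - p) * σ ^ 4) := by field_simp
    rw [this]
    have := frobInner_self_nonneg y
    have := hX.sum_sq_row_le i
    gcongr
  have h2 : (frobInner X' X' - frobInner X X) / (2 * σ ^ 2) ≤ √p / σ ^ 2 := by
    rw [← mul_div_mul_left (√p) (σ ^ 2) two_ne_zero]
    gcongr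
  have h3 : -(frobInner y y + frobInner X X) / (2 * σ ^ 2) =
      -(frobInner y y + frobInner X' X') / (2 * σ ^ 2) +
        (frobInner X' X' - frobInner X X) / (2 * σ ^ 2) := by ring
  linarith

/-- The condition on `σ²` says that `σ²` is at least the larger root of
`(n - p) ε s² - b s - 2 n p²`. -/
lemma logRatio_bound_le {n p ε σ γ b r : ℝ} (hp : 0 ≤ p) (hnp : p < n) (hε : 0 < ε) (hσ : 0 < σ)
    (hb : b = (n - p) * √p + 2 * p * γ)
    (hσ2 : (b + √(b ^ 2 + 8 * n * p ^ 2 * (n - p) * ε)) / (2 * (n - p) * ε) ≤ σ ^ 2)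
    (hr0 : 0 ≤ r) (hr : r ≤ 2 * (n * p) + 2 * (σ ^ 2 * γ)) :
    √p / σ ^ 2 + p * r / (2 * (n - p) * σ ^ 4) ≤ ε := by
  have hnp' : 0 < n - p := sub_pos.2 hnp
  have hn : 0 < n := hp.trans_lt hnp
  set D := b ^ 2 + 8 * n * p ^ 2 * (n - p) * ε with hD
  have hD0 : 0 ≤ D := by positivity
  rw [div_le_iff₀ (by positivity)] at hσ2
  have h1 : √D ≤ 2 * ((n - p) * ε) * σ ^ 2 - b := by linarith
  have h2 : D ≤ (2 * ((n - p) * ε) * σ ^ 2 - b) ^ 2 := by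
    rw [← Real.sq_sqrt hD0]
    gcongr
  have hq : b * σ ^ 2 + 2 * n * p ^ 2 ≤ (n - p) * ε * σ ^ 4 := by
    have h3 : 0 ≤ 4 * ((n - p) * ε) * ((n - p) * ε * σ ^ 4 - b * σ ^ 2 - 2 * n * p ^ 2) := by
      rw [hD] at h2; nlinarith
    have := nonneg_of_mul_nonneg_right h3 (by positivity)
    linarith
  -- The density bound has a factor `1 / 2` to spare, which is discarded here.
  have hpr : p * r ≤ 2 * (p * (2 * (n * p) + 2 * (σ ^ 2 * γ))) := by nlinarith
  have h4 : p * r / (2 * (n - p) * σ ^ 4) ≤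
      2 * (p * (2 * (n * p) + 2 * (σ ^ 2 * γ))) / (2 * (n - p) * σ ^ 4) := by gcongr
  refine (add_le_add_right h4 _).trans ?_
  have h5 : √p / σ ^ 2 + 2 * (p * (2 * (n * p) + 2 * (σ ^ 2 * γ))) / (2 * (n - p) * σ ^ 4) =
      (b * σ ^ 2 + 2 * n * p ^ 2) / ((n - p) * σ ^ 4) := by
    rw [hb]; field_simp; ring
  rw [h5, div_le_iff₀ (by positivity)]
  linarith

end Comparison

/-! ### The density ratio condition -/

section Mechanism

variable {Ω : Type*} [MeasurableSpace Ω] {n p : ℕ}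

/-- A release mechanism with the averaged Gaussian density satisfies the density ratio condition
once every output with an excessive density ratio forces the noise to exceed its quantile. -/
lemma densityRatioCondition_of_map_eq (P : Measure Ω) [IsProbabilityMeasure P] {ε δ σ : ℝ}
    (Y : Matrix (Fin n) (Fin p) ℝ → Ω → Matrix (Fin n) (Fin p) ℝ)
    (C : Ω → Matrix (Fin n) (Fin p) ℝ) (hC : HasLaw C (gaussianNoise n p σ) P)
    (hY : ∀ X, AEMeasurable (Y X) P)
    (hmap : ∀ X, Measure.map (Y X) P = (lebesgueMatrix n p).withDensity (mechanismDensity σ X))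
    (hratio : ∀ X X' : Matrix (Fin n) (Fin p) ℝ, IsDataSet X → IsDataSet X' → IsNeighbor X X' →
      ∀ ω, ENNReal.ofReal (Real.exp ε) * mechanismDensity σ X' (Y X ω) <
        mechanismDensity σ X (Y X ω) →
      σ ^ 2 * upperQuantile (chiSquare (n * p)) δ < frobInner (C ω) (C ω))
    (hσ : 0 < σ) (hδ0 : 0 < δ) (hδ1 : δ < 1) :
    DensityRatioCondition P ε δ Y := by
  intro X X' hX hX' hn
  have hpdf : ∀ Z, HasPDF (Y Z) P (lebesgueMatrix n p) := fun Z =>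
    hasPDF_of_map_eq_withDensity (hY Z) _ (measurable_mechanismDensity σ Z).aemeasurable (hmap Z)
  refine ⟨hpdf X, hpdf X', ?_⟩
  have hae : ∀ Z, pdf (Y Z) P (lebesgueMatrix n p) =ᵐ[lebesgueMatrix n p] mechanismDensity σ Z := by
    intro Z
    have := hpdf Z
    exact (pdf.eq_of_map_eq_withDensity _ (measurable_mechanismDensity σ Z).aemeasurable).1 (hmap Z)
  have hac : Measure.map (Y X) P ≪ lebesgueMatrix n p := by
    have := hpdf X
    exact HasPDF.absolutelyContinuous
  have hω : ∀ᵐ ω ∂P, pdf (Y X) P (lebesgueMatrix n p) (Y X ω) = mechanismDensity σ X (Y X ω) ∧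
      pdf (Y X') P (lebesgueMatrix n p) (Y X ω) = mechanismDensity σ X' (Y X ω) :=
    (ae_of_ae_map (hY X) (hac.ae_eq (hae X))).and (ae_of_ae_map (hY X) (hac.ae_eq (hae X')))
  calc P {ω | Y X ω ∈ exceedanceSet P ε (Y X) (Y X')}
      ≤ P {ω | σ ^ 2 * upperQuantile (chiSquare (n * p)) δ < frobInner (C ω) (C ω)} := by
        refine measure_mono_ae ?_
        filter_upwards [hω] with ω h hmem
        have hmem' : ENNReal.ofReal (Real.exp ε) * pdf (Y X') P (lebesgueMatrix n p) (Y X ω) <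
          pdf (Y X) P (lebesgueMatrix n p) (Y X ω) := hmem
        rw [h.1, h.2] at hmem'
        exact hratio X X' hX hX' hn ω hmem'
    _ = gaussianNoise n p σ {c | σ ^ 2 * upperQuantile (chiSquare (n * p)) δ < frobInner c c} :=
        hC.measure_eq (isOpen_lt continuous_const
          (continuous_frobInner continuous_id continuous_id)).measurableSet
    _ ≤ ENNReal.ofReal δ := gaussianNoise_frobInner_gt_le n p hσ hδ0 hδ1

end Mechanism

end MaskedDP

theorem mainTheorem1 {Ω : Type*} [MeasurableSpace Ω] (P : Measure Ω) [IsProbabilityMeasure P]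
    (n p : ℕ) (hpn : p < n) (ε δ σ : ℝ) (hε : 0 < ε) (hδ0 : 0 < δ) (hδ1 : δ < 1) (hσ : 0 < σ)
    (A : Ω → Matrix.orthogonalGroup (Fin n) ℝ) (C : Ω → Matrix (Fin n) (Fin p) ℝ)
    (hA : HasLaw A (MaskedDP.uniformOrthogonal n) P)
    (hC : HasLaw C (MaskedDP.gaussianNoise n p σ) P)
    (hAC : IndepFun A C P)
    (γ b : ℝ) (hγ : γ = MaskedDP.upperQuantile (MaskedDP.chiSquare (n * p)) δ)
    (hb : b = ((n : ℝ) - p) * Real.sqrt p + 2 * p * γ)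
    (hσ2 : (b + Real.sqrt (b ^ 2 + 8 * n * (p : ℝ) ^ 2 * ((n : ℝ) - p) * ε)) /
      (2 * ((n : ℝ) - p) * ε) ≤ σ ^ 2) :
    MaskedDP.DensityRatioCondition P ε δ
        (fun (X : Matrix (Fin n) (Fin p) ℝ) ω => (A ω : Matrix (Fin n) (Fin n) ℝ) * (X + C ω)) ∧
      MaskedDP.DensityRatioCondition P ε δ
        (fun (X : Matrix (Fin n) (Fin p) ℝ) ω => (A ω : Matrix (Fin n) (Fin n) ℝ) * X + C ω) := by
  have hlaw := hAC.hasLaw_prod hA hC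
  -- An output whose density ratio exceeds `e^ε` has large norm, hence so does the noise.
  have hratio : ∀ X X' : Matrix (Fin n) (Fin p) ℝ, MaskedDP.IsDataSet X → MaskedDP.IsDataSet X' →
      MaskedDP.IsNeighbor X X' → ∀ c y : Matrix (Fin n) (Fin p) ℝ,
      MaskedDP.frobInner y y ≤ 2 * MaskedDP.frobInner X X + 2 * MaskedDP.frobInner c c →
      ENNReal.ofReal (Real.exp ε) * MaskedDP.mechanismDensity σ X' y <
        MaskedDP.mechanismDensity σ X y →
      σ ^ 2 * MaskedDP.upperQuantile (MaskedDP.chiSquare (n * p)) δ < MaskedDP.frobInner c c := by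
    intro X X' hX hX' hn c y hy hlt
    by_contra! hle
    refine absurd hlt (not_lt.2
      (MaskedDP.mechanismDensity_le_of_isNeighbor hpn hσ hX hX' hn y ?_))
    refine MaskedDP.logRatio_bound_le (Nat.cast_nonneg p) (by exact_mod_cast hpn) hε hσ hb hσ2
      (MaskedDP.frobInner_self_nonneg y) ?_
    rw [← hγ] at hle
    have := hX.frobInner_self_le
    linarith
  constructor
  · have hT : ∀ X : Matrix (Fin n) (Fin p) ℝ, Measurable
        fun q : Matrix.orthogonalGroup (Fin n) ℝ × Matrix (Fin n) (Fin p) ℝ =>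
          (q.1 : Matrix (Fin n) (Fin n) ℝ) * (X + q.2) := fun X =>
      ((continuous_subtype_val.comp continuous_fst).matrix_mul
        (continuous_const.add continuous_snd)).measurable
    refine MaskedDP.densityRatioCondition_of_map_eq P _ C hC
      (fun X => (hT X).comp_aemeasurable hlaw.aemeasurable) (fun X => ?_)
      (fun X X' hX hX' hn ω => hratio X X' hX hX' hn (C ω) _ ?_) hσ hδ0 hδ1
    · have h := AEMeasurable.map_map_of_aemeasurable (hT X).aemeasurable hlaw.aemeasurable
      rw [hlaw.map_eq] at h
      refine h.symm.trans (MaskedDP.map_prod_eq_withDensity_mechanismDensity hσ X _ (hT X)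
        (fun B => ?_) fun B c => ?_)
      · exact (MaskedDP.measurePreserving_orthogonal_mul B).comp
          (measurePreserving_add_left (MaskedDP.lebesgueMatrix n p) X)
      · dsimp only
        rw [Matrix.mul_add, add_sub_cancel_left, MaskedDP.gaussianMatrixPDF_orthogonal_mul]
    · rw [MaskedDP.frobInner_orthogonal_mul]
      exact MaskedDP.frobInner_add_self_le X (C ω)
  · have hT : ∀ X : Matrix (Fin n) (Fin p) ℝ, Measurable
        fun q : Matrix.orthogonalGroup (Fin n) ℝ × Matrix (Fin n) (Fin p) ℝ =>
          (q.1 : Matrix (Fin n) (Fin n) ℝ) * X + q.2 := fun X =>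
      (((continuous_subtype_val.comp continuous_fst).matrix_mul
        continuous_const).add continuous_snd).measurable
    refine MaskedDP.densityRatioCondition_of_map_eq P _ C hC
      (fun X => (hT X).comp_aemeasurable hlaw.aemeasurable) (fun X => ?_)
      (fun X X' hX hX' hn ω => hratio X X' hX hX' hn (C ω) _ ?_) hσ hδ0 hδ1
    · have h := AEMeasurable.map_map_of_aemeasurable (hT X).aemeasurable hlaw.aemeasurable
      rw [hlaw.map_eq] at h
      refine h.symm.trans (MaskedDP.map_prod_eq_withDensity_mechanismDensity hσ X _ (hT X)
        (fun B => ?_) fun B c => ?_)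
      · exact measurePreserving_add_left (MaskedDP.lebesgueMatrix n p)
          ((B : Matrix (Fin n) (Fin n) ℝ) * X)
      · dsimp only
        rw [add_sub_cancel_left]
    · have h := MaskedDP.frobInner_add_self_le ((A ω : Matrix (Fin n) (Fin n) ℝ) * X) (C ω)
      rwa [MaskedDP.frobInner_orthogonal_mul] at h
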